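/- **Setting.** Let $(X,\mathcal B,\mu)$ be a $\sigma$-finite measure space, $1\le p<\infty$, and let $f:X\to X$ be a bijection with $f(B)\in\mathcal B$ and $f^{-1}(B)\in\mathcal B$ for all $B\in\mathcal B$. Suppose there is $c>0$ with $\mu(f^{-1}(B))\le c\,\mu(B)$ for all $B\in\mathcal B$, and let $T_f:L^p(\mu)\to L^p(\mu)$, $T_f\varphi=\varphi\circ f$, be the induced bounded composition operator on the complex space $L^p(\mu)$. Assume that $T_f$ is invertible, i.e. has a bounded inverse. Assume further that $(X,\mathcal B,\mu,f)$ is a dissipative system of bounded distortion generated by $W$, that is: - $f$ is non-singular: for $B\in\mathcal B$, $\mu(f^{-1}(B))=0$ if and only if $\mu(B)=0$; - $W\in\mathcal B$, $0<\mu(W)<\infty$, the sets $f^k(W)$, $k\in\mathbb Z$, are pairwise disjoint, and $X=\bigcup_{k\in\mathbb Z}f^k(W)$; - there is $K>0$ such that for all $k\in\mathbb Z$ and all measurable $B\subseteq W$, $$\tfrac1K\,\mu(f^k(W))\,\mu(B)\le\mu(f^k(B))\,\mu(W)\le K\,\mu(f^k(W))\,\mu(B).$$ **Definitions.** Let $T$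 be an invertible bounded linear operator on a complex Banach space $E$. - $T$ has the *shadowing property* if for each $\epsilon>0$ there is $\delta>0$ such that for every sequence $(x_n)_{n\in\mathbb Z}$ in $E$ with $\|Tx_n-x_{n+1}\|\le\delta$ for all $n\in\mathbb Z$ there is $x\in E$ with $\|T^nx-x_n\|<\epsilon$ for all $n\in\mathbb Z$. - $T$ is *generalized hyperbolic* if $E=M\oplus N$ with closed subspaces $M,N$ such that $T(M)\subseteq M$, $T^{-1}(N)\subseteq N$, and the spectra $\sigma(T|_M)$ and $\sigma(T^{-1}|_N)$ are contained in the open unit disk. - $T$ is *strongly structurally stable* if for every $\gamma>0$ there is $\epsilon>0$ such that for every bounded Lipschitz map $\phi:E\to E$ with $\|\phi\|_\infty\le\epsilon$ and $\mathrm{Lip}(\phi)\le\epsilon$ there is a homeomorphism $h:E\to E$ with $h\circ T=(T+\phi)\circ h$ and $\|h-I\|_\infty\le\gamma$. **Statement.** $T_f$ has the shadowing property if and only if it is generalized hyperbolic; and if $T_f$ has the shadowing property (equivalently, is generalized hyperbolic), then $T_f$ is strongly structurally stable. -/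

import Mathlib

open MeasureTheory
open scoped NNReal ENNReal BoundedContinuousFunction

/-! ### Dynamical properties of invertible bounded operators on a complex Banach space -/

section Operators

variable {E : Type*} [NormedAddCommGroup E] [NormedSpace ℂ E]

/-- The shadowing property of an invertible bounded operator `T`: for each `ε > 0` there is `δ > 0`
such that each `δ`-pseudotrajectory `(x n)`, `n ∈ ℤ`, is `ε`-shadowed by a trajectory of `T`. -/
def HasShadowingProperty (T : E ≃L[ℂ] E) : Prop :=
  ∀ ε : ℝ, 0 < ε → ∃ δ : ℝ, 0 < δ ∧
    ∀ x : ℤ → E, (∀ n : ℤ, ‖T (x n) - x (n + 1)‖ ≤ δ) →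
      ∃ y : E, ∀ n : ℤ, ‖(T ^ n) y - x n‖ < ε

/-- Generalized hyperbolicity of an invertible bounded operator `T`: the space is the direct sum of
two closed subspaces `M`, `N` with `T M ⊆ M`, `T⁻¹ N ⊆ N`, such that the spectra of `T|_M` (as an
operator on `M`) and of `T⁻¹|_N` (as an operator on `N`) lie in the open unit disk. -/
def IsGeneralizedHyperbolic (T : E ≃L[ℂ] E) : Prop :=
  ∃ (M N : Submodule ℂ E), IsClosed (M : Set E) ∧ IsClosed (N : Set E) ∧ IsCompl M N ∧
    ∃ (hM : Set.MapsTo (T : E →L[ℂ] E) M M) (hN : Set.MapsTo (T.symm : E →L[ℂ] E) N N),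
      spectrum ℂ ((T : E →L[ℂ] E).restrict hM) ⊆ Metric.ball (0 : ℂ) 1 ∧
      spectrum ℂ ((T.symm : E →L[ℂ] E).restrict hN) ⊆ Metric.ball (0 : ℂ) 1

/-- Strong structural stability of an invertible bounded operator `T`: for every `γ > 0` there is
`ε > 0` such that for each bounded Lipschitz map `φ` with `‖φ‖_∞ ≤ ε` and `Lip φ ≤ ε` there is a
homeomorphism `h` with `h ∘ T = (T + φ) ∘ h` and `‖h - I‖_∞ ≤ γ`. -/
def IsStronglyStructurallyStable (T : E ≃L[ℂ] E) : Prop :=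
  ∀ γ : ℝ, 0 < γ → ∃ ε : ℝ≥0, 0 < ε ∧
    ∀ φ : E →ᵇ E, ‖φ‖ ≤ ε → LipschitzWith ε φ →
      ∃ h : E ≃ₜ E, (∀ x, h (T x) = T (h x) + φ (h x)) ∧ ∀ x, ‖h x - x‖ ≤ γ

end Operators

/-! ### Composition operators -/

section Composition

variable {X : Type*} [MeasurableSpace X]

/-- `(X, 𝓑, μ, f)` underlies a composition dynamical system: `μ` is `σ`-finite, `f` is injective and
bimeasurable, and there is `c > 0` with `μ (f⁻¹ B) ≤ c μ B` for all measurable `B`. -/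
structure IsCompositionSystem (μ : Measure X) (f : X → X) : Prop where
  sigmaFinite : SigmaFinite μ
  injective : Function.Injective f
  measurable : Measurable f
  measurableSet_image : ∀ B : Set X, MeasurableSet B → MeasurableSet (f '' B)
  exists_bound : ∃ c : ℝ≥0, 0 < c ∧ ∀ B : Set X, MeasurableSet B → μ (f ⁻¹' B) ≤ c * μ B

theorem IsCompositionSystem.exists_map_le {μ : Measure X} {f : X → X}
    (hf : IsCompositionSystem μ f) : ∃ c : ℝ≥0, μ.map f ≤ (c : ℝ≥0∞) • μ := by
  obtain ⟨c, -, hc⟩ := hf.exists_bound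
  refine ⟨c, Measure.le_iff.2 fun B hB => ?_⟩
  rw [Measure.map_apply hf.measurable hB]
  simpa using hc B hB

theorem IsCompositionSystem.quasiMeasurePreserving {μ : Measure X} {f : X → X}
    (hf : IsCompositionSystem μ f) : Measure.QuasiMeasurePreserving f μ μ := by
  obtain ⟨c, hc⟩ := hf.exists_map_le
  exact ⟨hf.measurable, Measure.absolutelyContinuous_of_le_smul hc⟩

theorem IsCompositionSystem.exists_eLpNorm_comp_le {μ : Measure X} {f : X → X}
    (hf : IsCompositionSystem μ f) (p : ℝ≥0∞) : ∃ C : ℝ≥0, ∀ g : X →ₘ[μ] ℂ,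
      eLpNorm (g.compQuasiMeasurePreserving f hf.quasiMeasurePreserving) p μ
        ≤ C * eLpNorm g p μ := by
  obtain ⟨c, hc⟩ := hf.exists_map_le
  refine ⟨c ^ (1 / p).toReal, fun g => ?_⟩
  have hac := Measure.absolutelyContinuous_of_le_smul hc
  rw [eLpNorm_congr_ae (g.coeFn_compQuasiMeasurePreserving hf.quasiMeasurePreserving),
    ← eLpNorm_map_measure (g.aestronglyMeasurable.mono_ac hac) hf.measurable.aemeasurable]
  refine (eLpNorm_le_of_measure_le_smul hc).trans (le_of_eq ?_)
  rw [ENNReal.coe_rpow_of_nonneg _ ENNReal.toReal_nonneg, smul_eq_mul]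

/-- The composition operator `T_f : φ ↦ φ ∘ f` on the complex space `L^p(μ)`, as a bounded linear
operator. -/
noncomputable def compositionOperator {μ : Measure X} {f : X → X} (hf : IsCompositionSystem μ f)
    (p : ℝ≥0∞) [Fact (1 ≤ p)] : Lp ℂ p μ →L[ℂ] Lp ℂ p μ :=
  LinearMap.mkContinuousOfExistsBound
    { toFun := fun g =>
        ⟨(g : X →ₘ[μ] ℂ).compQuasiMeasurePreserving f hf.quasiMeasurePreserving, by
          obtain ⟨C, hC⟩ := hf.exists_eLpNorm_comp_le p
          exact Lp.mem_Lp_iff_eLpNorm_lt_top.2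
            ((hC g).trans_lt (ENNReal.mul_lt_top ENNReal.coe_lt_top (Lp.eLpNorm_lt_top g)))⟩
      map_add' := by
        rintro ⟨⟨_⟩, _⟩ ⟨⟨_⟩, _⟩
        rfl
      map_smul' := by
        rintro c ⟨⟨_⟩, _⟩
        rfl }
    (by
      obtain ⟨C, hC⟩ := hf.exists_eLpNorm_comp_le p
      refine ⟨C, fun g => ?_⟩
      have h := ENNReal.toReal_mono
        (ENNReal.mul_ne_top ENNReal.coe_ne_top (Lp.eLpNorm_ne_top g)) (hC g)
      rw [ENNReal.toReal_mul, ENNReal.coe_toReal] at h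
      exact h)

theorem compositionOperator_coeFn {μ : Measure X} {f : X → X} (hf : IsCompositionSystem μ f)
    (p : ℝ≥0∞) [Fact (1 ≤ p)] (g : Lp ℂ p μ) :
    compositionOperator hf p g =ᵐ[μ] g ∘ f :=
  (g : X →ₘ[μ] ℂ).coeFn_compQuasiMeasurePreserving hf.quasiMeasurePreserving

/-- The image `f^k(A)` of a set under the `k`-th iterate, `k ∈ ℤ`, of an invertible map `f`. -/
def iterImage (f : X ≃ᵐ X) (k : ℤ) (A : Set X) : Set X :=
  ((f.toEquiv : Equiv.Perm X) ^ k : Equiv.Perm X) '' A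

/-- `(X, 𝓑, μ, f)`, with `f` invertible, is a dissipative system generated by `W`. -/
structure IsDissipativeSystem (μ : Measure X) (f : X ≃ᵐ X) (W : Set X) : Prop where
  nonsingular : ∀ B : Set X, MeasurableSet B → (μ (f ⁻¹' B) = 0 ↔ μ B = 0)
  measurableSet : MeasurableSet W
  measure_pos : 0 < μ W
  measure_lt_top : μ W < ∞
  pairwise_disjoint : Pairwise fun j k : ℤ => Disjoint (iterImage f j W) (iterImage f k W)
  iUnion_eq : ⋃ k : ℤ, iterImage f k W = Set.univ

/-- `(X, 𝓑, μ, f)` is a dissipative system, of bounded distortion, generated by `W`: for some `K > 0`,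
`(1/K) μ(f^k W) μ(B) ≤ μ(f^k B) μ(W) ≤ K μ(f^k W) μ(B)` for all `k ∈ ℤ` and measurable `B ⊆ W`. -/
structure IsDissipativeSystemOfBoundedDistortion (μ : Measure X) (f : X ≃ᵐ X) (W : Set X) : Prop
    extends IsDissipativeSystem μ f W where
  bounded_distortion : ∃ K : ℝ≥0, 0 < K ∧ ∀ (k : ℤ) (B : Set X), MeasurableSet B → B ⊆ W →
    (K : ℝ≥0∞)⁻¹ * (μ (iterImage f k W) * μ B) ≤ μ (iterImage f k B) * μ W ∧
    μ (iterImage f k B) * μ W ≤ K * (μ (iterImage f k W) * μ B)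

end Composition

open MeasureTheory Filter Topology
open scoped NNReal ENNReal BoundedContinuousFunction

/-! ### Spectral radius estimates, Green kernels and shadowing -/

section BanachSpace

variable {E : Type*} [NormedAddCommGroup E] [NormedSpace ℂ E]

/-! Generalized hyperbolicity yields both dynamical properties through a Green kernel. If `P` and
`Q` are the projections onto `M` and `N`, the operators `T^(k-1) P` for `k > 0` and `-T^(k-1) Q` for
`k ≤ 0` are summable in norm, and convolution with them solves `u (n+1) = T (u n) + z n` for bounded
`z`. Correcting a pseudotrajectory by such a `u` gives shadowing
(`IsGreenKernel.hasShadowingProperty`); the same convolution along orbits solves cohomological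
equations, and a contraction argument then conjugates `T` with `T + φ`
(`IsGreenKernel.exists_conj`).

The converse uses the dissipative structure. Let `e` be the indicator of `W` and `v n = ‖T^n e‖ =
μ(f^(-n) W)^(1/p)`. The sequence `σ n • T^n e`, with `σ (n+1) - σ n = δ / v (n+1)`, is a
`δ`-pseudotrajectory. Averaging over `W` turns a shadowing orbit into a constant `c` with `|σ n - c|
≤ C / v n` (`exists_orbit_functional`). Thus `s = σ - c` is an increasing sequence dominated by its
own increments, which forces geometric growth of `1 / v` forwards where `s > 0` and backwards where
`s ≤ 0` (`exists_exponential_growth`). The times with `s > 0` form an up-set `A`, possibly empty or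
all of `ℤ`. Bounded distortion carries the decay of `v` over to every function supported on the
pieces `f^(-n) W` with `n ∈ A`, or with `n ∉ A` (`norm_zpow_le_of_ae_eq_zero`); these two spaces of
functions are `M` and `N`.

Structural stability then follows from shadowing by way of generalized hyperbolicity. -/

theorem ContinuousLinearEquiv.zpow_add_one_apply (T : E ≃L[ℂ] E) (n : ℤ) (x : E) :
    (T ^ (n + 1)) x = T ((T ^ n) x) := by
  rw [add_comm, zpow_add, zpow_one]
  rfl

theorem ContinuousLinearEquiv.zpow_add_apply (T : E ≃L[ℂ] E) (m n : ℤ) (x : E) :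
    (T ^ (m + n)) x = (T ^ m) ((T ^ n) x) := by
  rw [zpow_add]
  rfl

theorem ContinuousLinearEquiv.zpow_neg_apply_zpow (T : E ≃L[ℂ] E) (n : ℤ) (x : E) :
    (T ^ (-n)) ((T ^ n) x) = x := by
  rw [← T.zpow_add_apply, neg_add_cancel, zpow_zero]
  rfl

theorem ContinuousLinearEquiv.coe_restrict_pow (T : E ≃L[ℂ] E) {M : Submodule ℂ E}
    (hM : Set.MapsTo (T : E →L[ℂ] E) M M) (n : ℕ) (x : M) :
    ((((T : E →L[ℂ] E).restrict hM) ^ n) x : E) = (T ^ (n : ℤ)) x := by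
  induction n with
  | zero => rfl
  | succ n ih =>
    rw [Nat.cast_succ, T.zpow_add_one_apply, ← ih, pow_succ']
    rfl

theorem ContinuousLinearEquiv.coe_symm_restrict_pow (T : E ≃L[ℂ] E) {N : Submodule ℂ E}
    (hN : Set.MapsTo (T.symm : E →L[ℂ] E) N N) (n : ℕ) (x : N) :
    ((((T.symm : E →L[ℂ] E).restrict hN) ^ n) x : E) = (T ^ (-n : ℤ)) x := by
  rw [T.symm.coe_restrict_pow hN, ← inv_zpow']
  rfl

/-- The powers of an operator with spectrum in the open unit disk are summable in norm. -/
theorem summable_norm_pow_of_spectrum_subset_ball {A : Type*} [NormedRing A] [NormedAlgebra ℂ A]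
    [CompleteSpace A] (a : A) (ha : spectrum ℂ a ⊆ Metric.ball 0 1) :
    Summable fun n : ℕ => ‖a ^ n‖ := by
  -- The trivial ring does occur: it is the endomorphism ring of a zero summand.
  rcases subsingleton_or_nontrivial A with hA | hA
  · refine summable_zero.congr fun n => ?_
    rw [Subsingleton.elim (a ^ n) 0, norm_zero]
  have h1 : spectralRadius ℂ a < (1 : ℝ≥0) :=
    spectrum.spectralRadius_lt_of_forall_lt a fun z hz => by
      have := ha hz
      rw [mem_ball_zero_iff] at this
      exact_mod_cast this
  obtain ⟨r, hr0, hr1⟩ := ENNReal.lt_iff_exists_nnreal_btwn.1 h1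
  have hr1' : r < 1 := by exact_mod_cast hr1
  refine Summable.of_norm_bounded_eventually_nat (g := fun n : ℕ => (r : ℝ) ^ n)
    (summable_geometric_of_lt_one r.2 (by exact_mod_cast hr1')) ?_
  -- By Gelfand's formula, `‖a ^ n‖ ≤ r ^ n` for all large `n`.
  filter_upwards [(spectrum.pow_nnnorm_pow_one_div_tendsto_nhds_spectralRadius a).eventually
    (gt_mem_nhds hr0), eventually_gt_atTop 0] with n hn hn0
  rw [norm_norm]
  have h2 : ((‖a ^ n‖₊ : ℝ≥0∞)) ≤ (r : ℝ≥0∞) ^ n := by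
    have := ENNReal.rpow_le_rpow hn.le (z := (n : ℝ)) n.cast_nonneg
    rwa [← ENNReal.rpow_mul, one_div_mul_cancel (by exact_mod_cast hn0.ne'), ENNReal.rpow_one,
      ENNReal.rpow_natCast] at this
  exact_mod_cast h2

/-- The spectrum lies in the open unit disk as soon as some power has norm less than one. -/
theorem spectrum_subset_ball_of_norm_pow_lt_one [CompleteSpace E] (S : E →L[ℂ] E) {n : ℕ}
    (hS : ‖S ^ n‖ < 1) : spectrum ℂ S ⊆ Metric.ball 0 1 := by
  intro z hz
  rw [mem_ball_zero_iff]
  by_contra! h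
  have h1 := spectrum.norm_le_norm_mul_of_mem (spectrum.pow_mem_pow S n hz)
  rw [norm_pow] at h1
  have h2 : ‖(1 : E →L[ℂ] E)‖ ≤ 1 := ContinuousLinearMap.norm_id_le
  nlinarith [one_le_pow₀ h (n := n), norm_nonneg (S ^ n)]

theorem norm_le_of_apply_eq_coe {M : Submodule ℂ E} (L : E →L[ℂ] E) (S : M →L[ℂ] M) (P : E →L[ℂ] M)
    (h : ∀ x, L x = S (P x)) : ‖L‖ ≤ ‖S‖ * ‖P‖ := by
  refine L.opNorm_le_bound (by positivity) fun x => ?_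
  rw [h, mul_assoc]
  exact S.le_opNorm_of_le (P.le_opNorm x)

/-- A two-sided summable fundamental solution of the difference equation `u (n + 1) = T (u n) + z n`
with operator coefficients. -/
structure IsGreenKernel (T : E ≃L[ℂ] E) (A : ℤ → E →L[ℂ] E) : Prop where
  summable : Summable fun k => ‖A k‖
  succ_apply : ∀ k x, A (k + 1) x = T (A k x) + if k = 0 then x else 0

/-- Forward powers of `T` are summable on `M` and backward powers on `N`, so each component of an
impulse is propagated in its own contracting direction. The exponent `k - 1` places the jump at `k =
0`: there `A 1 - T ∘ A 0 = P + Q = 1`. -/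
theorem IsGeneralizedHyperbolic.exists_isGreenKernel [CompleteSpace E] {T : E ≃L[ℂ] E}
    (hT : IsGeneralizedHyperbolic T) : ∃ A : ℤ → E →L[ℂ] E, IsGreenKernel T A := by
  obtain ⟨M, N, hMc, hNc, hMN, hM, hN, hσM, hσN⟩ := hT
  have : CompleteSpace M := hMc.completeSpace_coe
  have : CompleteSpace N := hNc.completeSpace_coe
  have hc : Submodule.IsTopCompl M N := Submodule.IsCompl.isTopCompl_of_isClosed hMN hMc hNc
  set P : E →L[ℂ] M := M.projectionOntoL N hc
  set Q : E →L[ℂ] N := N.projectionOntoL M hc.symm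
  have hPQ : ∀ x, (P x : E) + Q x = x := fun x =>
    Submodule.projectionL_add_projectionL_eq_self hc x
  set SM := (T : E →L[ℂ] E).restrict hM
  set SN := (T.symm : E →L[ℂ] E).restrict hN
  have hpowM : ∀ (n : ℕ) (x : M), ((SM ^ n) x : E) = (T ^ (n : ℤ)) x := T.coe_restrict_pow hM
  have hpowN : ∀ (n : ℕ) (x : N), ((SN ^ n) x : E) = (T ^ (-n : ℤ)) x := T.coe_symm_restrict_pow hN
  have hsM : Summable fun n : ℕ => ‖SM ^ n‖ := summable_norm_pow_of_spectrum_subset_ball SM hσM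
  have hsN : Summable fun n : ℕ => ‖SN ^ n‖ := summable_norm_pow_of_spectrum_subset_ball SN hσN
  refine ⟨fun k => if 0 < k then ((T ^ (k - 1) : E ≃L[ℂ] E) : E →L[ℂ] E) ∘L M.subtypeL ∘L P
    else -(((T ^ (k - 1) : E ≃L[ℂ] E) : E →L[ℂ] E) ∘L N.subtypeL ∘L Q), ?_, ?_⟩
  -- After the shift by one, the two halves are the powers `SM ^ n` and `SN ^ (n + 1)`, for `n : ℕ`,
  -- composed with the projections.
  · rw [← (Equiv.addRight (1 : ℤ)).summable_iff]
    refine Summable.of_nat_of_neg_add_one ?_ ?_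
    · refine Summable.of_nonneg_of_le (fun _ => norm_nonneg _) (fun n => ?_)
        (hsM.mul_right ‖P‖)
      have h0 : (0 : ℤ) < n + 1 := by positivity
      simp only [Function.comp_apply, Equiv.coe_addRight, h0, if_true, add_sub_cancel_right]
      refine norm_le_of_apply_eq_coe _ (SM ^ n) P fun x => ?_
      rw [hpowM]
      rfl
    · refine Summable.of_nonneg_of_le (fun _ => norm_nonneg _) (fun n => ?_)
        (((summable_nat_add_iff 1).2 hsN).mul_right ‖Q‖)
      have h0 : ¬ (0 : ℤ) < -(n + 1) + 1 := by lia
      simp only [Function.comp_apply, Equiv.coe_addRight, h0, if_false, add_sub_cancel_right,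
        norm_neg]
      refine norm_le_of_apply_eq_coe _ (SN ^ (n + 1)) Q fun x => ?_
      rw [hpowN]
      push_cast
      rfl
  · intro k x
    have hT : T ((T ^ (k - 1)) (Q x : E)) = (T ^ k) (Q x : E) := by
      rw [← T.zpow_add_one_apply, sub_add_cancel]
    have hT' : T ((T ^ (k - 1)) (P x : E)) = (T ^ k) (P x : E) := by
      rw [← T.zpow_add_one_apply, sub_add_cancel]
    rcases lt_trichotomy k 0 with hk | rfl | hk
    · have h1 : ¬ 0 < k + 1 := by lia
      have h2 : ¬ 0 < k := by lia
      simp only [h1, h2, hk.ne, if_false, add_zero, add_sub_cancel_right]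
      simp [hT]
    · simp only [lt_irrefl, if_false, zero_add, zero_lt_one, if_true, sub_self]
      rw [zpow_zero] at hT
      simp only [zero_sub] at hT
      have h3 : ((T ^ (0 : ℤ) : E ≃L[ℂ] E)) (P x : E) = P x := rfl
      simp only [neg_apply, ContinuousLinearMap.comp_apply, map_neg,
        ContinuousLinearEquiv.coe_coe, Submodule.subtypeL_apply, zero_sub, h3, hT]
      change (P x : E) = -(Q x : E) + x
      rw [eq_neg_add_iff_add_eq, add_comm, hPQ]
    · have h1 : 0 < k + 1 := by lia
      simp only [h1, hk, hk.ne', if_false, add_zero, add_sub_cancel_right, if_true]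
      simp [hT']

namespace IsGreenKernel

variable {T : E ≃L[ℂ] E} {A : ℤ → E →L[ℂ] E}

theorem norm_apply_le (A : ℤ → E →L[ℂ] E) {z : ℤ → E} {c : ℝ} (hz : ∀ n, ‖z n‖ ≤ c) (n k : ℤ) :
    ‖A k (z n)‖ ≤ ‖A k‖ * c := (A k).le_opNorm_of_le (hz n)

theorem summable_apply [CompleteSpace E] (hA : IsGreenKernel T A) {z : ℤ → E} {c : ℝ}
    (hz : ∀ n, ‖z n‖ ≤ c) (m : ℤ → ℤ) : Summable fun k => A k (z (m k)) :=
  Summable.of_norm_bounded (hA.summable.mul_right c) fun k => norm_apply_le A hz (m k) k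

/-- Convolution with a Green kernel solves the inhomogeneous difference equation. -/
theorem tsum_succ [CompleteSpace E] (hA : IsGreenKernel T A) {z : ℤ → E} {c : ℝ}
    (hz : ∀ n, ‖z n‖ ≤ c) (n : ℤ) :
    ∑' k, A k (z (n - k)) = T (∑' k, A k (z (n - 1 - k))) + z (n - 1) := by
  -- The inhomogeneous term is written as a sum concentrated at `k = 0`, so that the recursion for
  -- `A` applies termwise.
  rw [← (Equiv.addRight (1 : ℤ)).tsum_eq fun k => A k (z (n - k)),
    T.map_tsum, ← (hasSum_ite_eq (0 : ℤ) (z (n - 1))).tsum_eq, ← Summable.tsum_add]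
  · refine tsum_congr fun k => ?_
    rw [Equiv.coe_addRight, hA.succ_apply, show n - (k + 1) = n - 1 - k by ring]
    rcases eq_or_ne k 0 with rfl | hk
    · simp
    · simp [hk]
  · exact T.summable.2 (hA.summable_apply hz _)
  · exact (hasSum_ite_eq _ _).summable

theorem norm_tsum_le (hA : IsGreenKernel T A) {z : ℤ → E} {c : ℝ}
    (hz : ∀ n, ‖z n‖ ≤ c) (m : ℤ → ℤ) : ‖∑' k, A k (z (m k))‖ ≤ (∑' k, ‖A k‖) * c :=
  tsum_of_norm_bounded (hA.summable.hasSum.mul_right c) fun k => norm_apply_le A hz (m k) k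

/-- Subtracting from a pseudotrajectory the bounded solution `u` driven by its errors `z` leaves an
exact orbit, at distance `‖u n‖` from it. -/
theorem hasShadowingProperty [CompleteSpace E] (hA : IsGreenKernel T A) :
    HasShadowingProperty T := by
  intro ε hε
  set a := ∑' k, ‖A k‖
  have ha : 0 ≤ a := tsum_nonneg fun _ => norm_nonneg _
  refine ⟨ε / (2 * (a + 1)), by positivity, fun x hx => ?_⟩
  set z : ℤ → E := fun n => x (n + 1) - T (x n) with hzdef
  have hz : ∀ n, ‖z n‖ ≤ ε / (2 * (a + 1)) := fun n => by
    rw [hzdef, norm_sub_rev]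
    exact hx n
  set u : ℤ → E := fun n => ∑' k, A k (z (n - k)) with hu
  have hrec : ∀ n, x (n + 1) - u (n + 1) = T (x n - u n) := fun n => by
    have := hA.tsum_succ hz (n + 1)
    rw [add_sub_cancel_right] at this
    change x (n + 1) - ∑' k, A k (z (n + 1 - k)) = T (x n - u n)
    rw [this, map_sub]
    change x (n + 1) - (T (u n) + (x (n + 1) - T (x n))) = _
    abel
  have horb : ∀ n : ℤ, (T ^ n) (x 0 - u 0) = x n - u n := by
    intro n
    induction n with
    | zero => rfl
    | succ n ih => rw [T.zpow_add_one_apply, ih, hrec]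
    | pred n ih =>
      have := hrec (-n - 1)
      rw [sub_add_cancel, ← ih, ← sub_add_cancel (-(n : ℤ)) 1, T.zpow_add_one_apply] at this
      simpa using T.injective this
  refine ⟨x 0 - u 0, fun n => ?_⟩
  rw [horb, sub_sub_cancel_left, norm_neg]
  refine (hA.norm_tsum_le hz _).trans_lt ?_
  rw [mul_div_assoc', div_lt_iff₀ (by positivity)]
  nlinarith

end IsGreenKernel

end BanachSpace

/-! ### Conjugating a small Lipschitz perturbation to the linear operator -/

section StructuralStability

variable {E : Type*} [NormedAddCommGroup E]

theorem Homeomorph.semiconj_zpow {Y Z : Type*} [TopologicalSpace Y] [TopologicalSpace Z]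
    {R : Y ≃ₜ Y} {S : Z ≃ₜ Z} {h : Y → Z} (hh : ∀ x, h (R x) = S (h x)) (n : ℤ) (x : Y) :
    h ((R ^ n) x) = (S ^ n) (h x) := by
  induction n generalizing x with
  | zero => rfl
  | succ n ih => rw [zpow_add_one, zpow_add_one, Homeomorph.mul_apply, Homeomorph.mul_apply, ih, hh]
  | pred n ih =>
    have h1 : h (R⁻¹ x) = S⁻¹ (h x) := by
      apply S.injective
      rw [← hh]
      change h (R (R.symm x)) = S (S.symm (h x))
      simp
    rw [zpow_sub_one, zpow_sub_one, Homeomorph.mul_apply, Homeomorph.mul_apply, ih, h1]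

variable [NormedSpace ℂ E]

namespace IsGreenKernel

variable [CompleteSpace E] {T : E ≃L[ℂ] E} {A : ℤ → E →L[ℂ] E}

/-- The bounded solution `w` of the cohomological equation `w ∘ R = T ∘ w + v` given by a Green
kernel of `T`. -/
noncomputable def conv (hA : IsGreenKernel T A) (R : E ≃ₜ E) (v : E →ᵇ E) : E →ᵇ E :=
  BoundedContinuousFunction.ofNormedAddCommGroup (fun x => ∑' k : ℤ, A k (v ((R ^ (-k)) x)))
    (continuous_tsum (fun k => (A k).continuous.comp (v.continuous.comp (R ^ (-k)).continuous))
      (hA.summable.mul_right ‖v‖) fun k _ => (A k).le_opNorm_of_le (v.norm_coe_le_norm _))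
    ((∑' k, ‖A k‖) * ‖v‖) fun x =>
      hA.norm_tsum_le (z := fun n => v ((R ^ n) x)) (fun _ => v.norm_coe_le_norm _) fun k => -k

theorem conv_apply (hA : IsGreenKernel T A) (R : E ≃ₜ E) (v : E →ᵇ E) (x : E) :
    hA.conv R v x = ∑' k : ℤ, A k (v ((R ^ (-k)) x)) := rfl

theorem conv_apply_map (hA : IsGreenKernel T A) (R : E ≃ₜ E) (v : E →ᵇ E) (x : E) :
    hA.conv R v (R x) = T (hA.conv R v x) + v x := by
  have h := hA.tsum_succ (z := fun n => v ((R ^ n) x)) (fun _ => v.norm_coe_le_norm _) 1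
  simp only [sub_self, zero_sub] at h
  rw [conv_apply, conv_apply]
  refine Eq.trans (tsum_congr fun k => ?_) h
  rw [sub_eq_neg_add, zpow_add_one]
  rfl

theorem norm_conv_sub_le (hA : IsGreenKernel T A) (R : E ≃ₜ E) {v w : E →ᵇ E} {c : ℝ}
    (hvw : ∀ x, ‖v x - w x‖ ≤ c) (x : E) :
    ‖hA.conv R v x - hA.conv R w x‖ ≤ (∑' k, ‖A k‖) * c := by
  rw [conv_apply, conv_apply, ← Summable.tsum_sub
    (hA.summable_apply (z := fun n => v ((R ^ n) x)) (fun _ => v.norm_coe_le_norm _) fun k => -k)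
    (hA.summable_apply (z := fun n => w ((R ^ n) x)) (fun _ => w.norm_coe_le_norm _) fun k => -k)]
  simp only [← map_sub]
  exact hA.norm_tsum_le (z := fun n => v ((R ^ n) x) - w ((R ^ n) x)) (fun _ => hvw _) fun k => -k

theorem norm_conv_le (hA : IsGreenKernel T A) (R : E ≃ₜ E) {v : E →ᵇ E} {c : ℝ}
    (hv : ‖v‖ ≤ c) (x : E) : ‖hA.conv R v x‖ ≤ (∑' k, ‖A k‖) * c :=
  hA.norm_tsum_le (z := fun n => v ((R ^ n) x)) (fun _ => (v.norm_coe_le_norm _).trans hv)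
    fun k => -k

/-- A Lipschitz-small bounded perturbation of `T` is a homeomorphism conjugate to `T`. -/
theorem exists_conj (hA : IsGreenKernel T A) {φ : E →ᵇ E} {ε : ℝ≥0} (hφ : LipschitzWith ε φ)
    (hεA : (∑' k, ‖A k‖) * ε ≤ 1 / 2)
    (hεT : Subsingleton E ∨ ε < ‖(T.symm : E →L[ℂ] E)‖₊⁻¹) :
    ∃ h : E ≃ₜ E, (∀ x, h (T x) = T (h x) + φ (h x)) ∧
      ∀ x, ‖h x - x‖ ≤ (∑' k, ‖A k‖) * ‖φ‖ := by
  have happrox : ApproximatesLinearOn (fun x => T x + φ x) (T : E →L[ℂ] E) Set.univ ε := by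
    intro x _ y _
    have h1 : T x + φ x - (T y + φ y) - T (x - y) = φ x - φ y := by
      rw [map_sub]
      abel
    have h2 := hφ.dist_le_mul x y
    rwa [dist_eq_norm, dist_eq_norm, ← h1] at h2
  -- `T + φ` is a homeomorphism, as a perturbation of `T` with Lipschitz constant below `‖T⁻¹‖⁻¹`.
  set S : E ≃ₜ E := happrox.toHomeomorph _ hεT with hS
  have hSx : ∀ x, S x = T x + φ x := fun x => rfl
  set R : E ≃ₜ E := T.toHomeomorph with hR
  have hRx : ∀ x, R x = T x := fun x => rfl
  have ha : 0 ≤ ∑' k, ‖A k‖ := tsum_nonneg fun _ => norm_nonneg _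
  set pert : (E →ᵇ E) → C(E, E) := fun u => ⟨fun x => x + u x, by fun_prop⟩ with hpert
  -- With `h = 1 + u`, the equation `h ∘ T = (T + φ) ∘ h` reads `u ∘ T = T ∘ u + φ ∘ (1 + u)`, which
  -- every fixed point of `Φ` satisfies.
  set Φ : (E →ᵇ E) → (E →ᵇ E) := fun u => hA.conv R (φ.compContinuous (pert u)) with hΦ
  have hcontr : ContractingWith (1 / 2) Φ := by
    refine ⟨by norm_num, LipschitzWith.of_dist_le_mul fun u v => ?_⟩
    rw [dist_eq_norm, dist_eq_norm, BoundedContinuousFunction.norm_le (by positivity)]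
    intro x
    refine (hA.norm_conv_sub_le R (c := ε * ‖u - v‖) (fun y => ?_) x).trans ?_
    · refine (dist_eq_norm (φ (y + u y)) (φ (y + v y))).symm.trans_le
        ((hφ.dist_le_mul _ _).trans ?_)
      rw [dist_add_left, dist_eq_norm]
      gcongr
      exact (u - v).norm_coe_le_norm y
    · rw [← mul_assoc]
      gcongr
      simpa using hεA
  set u := hcontr.fixedPoint with hu
  have hfix : hA.conv R (φ.compContinuous (pert u)) = u := hcontr.fixedPoint_isFixedPt
  set h : C(E, E) := pert u with hh
  have hhx : ∀ x, h x = x + u x := fun x => rfl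
  -- The inverse `g = 1 - w` must satisfy `g ∘ S = T ∘ g`, that is `w ∘ S = T ∘ w + φ`. This is
  -- linear in `w`, so no fixed point is needed.
  set w := hA.conv S φ with hw
  set g : C(E, E) := ⟨fun x => x - w x, by fun_prop⟩ with hg
  have hgx : ∀ x, g x = x - w x := fun x => rfl
  have hsemi : ∀ x, h (R x) = S (h x) := fun x => by
    have := hA.conv_apply_map R (φ.compContinuous h) x
    rw [hfix] at this
    rw [hhx, this, hSx, hRx, hhx, map_add, ← hhx]
    exact (add_assoc _ _ _).symm
  have gsemi : ∀ x, g (S x) = R (g x) := fun x => by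
    rw [hgx, hw, hA.conv_apply_map, hSx, hRx, hgx, map_sub]
    abel
  have hux : ∀ x, u x = ∑' k : ℤ, A k (φ (h ((R ^ (-k)) x))) := fun x => by
    nth_rw 1 [← hfix]
    rfl
  have hleft : ∀ x, g (h x) = x := fun x => by
    have : w (h x) = u x := by
      rw [hux, hw, conv_apply]
      simp only [Homeomorph.semiconj_zpow hsemi]
    rw [hgx, this, hhx, add_sub_cancel_right]
  -- The defect `D = h ∘ g - 1` is a difference of convolutions along `S`, whence `‖D‖ ≤ ‖D‖ / 2`.
  have hright : ∀ x, h (g x) = x := by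
    set D : E →ᵇ E := u.compContinuous g - w with hD
    have hDx : ∀ x, h (g x) - x = D x := fun x => by
      rw [hhx, hgx]
      change _ = u (g x) - w x
      rw [hgx]
      abel
    have hDc : ∀ x, D x = hA.conv S (φ.compContinuous (h.comp g)) x - hA.conv S φ x := fun x => by
      change u (g x) - w x = _
      rw [hux, conv_apply]
      simp only [← Homeomorph.semiconj_zpow gsemi]
      rfl
    have hDn : ‖D‖ ≤ (∑' k, ‖A k‖) * (ε * ‖D‖) := by
      refine (BoundedContinuousFunction.norm_le (by positivity)).2 fun x => ?_
      rw [hDc]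
      refine hA.norm_conv_sub_le S (fun y => ?_) x
      refine (dist_eq_norm (φ (h (g y))) (φ y)).symm.trans_le ((hφ.dist_le_mul _ _).trans ?_)
      rw [dist_eq_norm, hDx]
      gcongr
      exact D.norm_coe_le_norm y
    have hD0 : D = 0 := by
      rw [← norm_le_zero_iff]
      nlinarith [norm_nonneg D]
    intro x
    rw [← sub_eq_zero, hDx, hD0]
    rfl
  refine ⟨⟨⟨h, g, hleft, hright⟩, h.continuous, g.continuous⟩, hsemi, fun x => ?_⟩
  change ‖h x - x‖ ≤ _
  rw [hhx, add_sub_cancel_left, ← hfix]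
  refine hA.norm_conv_le R ?_ x
  exact (BoundedContinuousFunction.norm_le (norm_nonneg _)).2 fun y => φ.norm_coe_le_norm _

theorem isStronglyStructurallyStable (hA : IsGreenKernel T A) :
    IsStronglyStructurallyStable T := by
  intro γ hγ
  set a := ∑' k, ‖A k‖ with ha'
  have ha : 0 ≤ a := tsum_nonneg fun _ => norm_nonneg _
  set N : ℝ≥0 := ‖(T.symm : E →L[ℂ] E)‖₊ with hN
  set m : ℝ≥0 := min ⟨γ, hγ.le⟩ (1 / 2) with hm
  have hm0 : 0 < m := lt_min hγ (by norm_num)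
  have hmγ : (m : ℝ) ≤ γ := by exact_mod_cast min_le_left (⟨γ, hγ.le⟩ : ℝ≥0) (1 / 2)
  have hm2 : (m : ℝ) ≤ 1 / 2 := by
    have : m ≤ 1 / 2 := min_le_right _ _
    exact_mod_cast this
  -- This choice gives `a ε ≤ m`, hence contraction by `1 / 2` and displacement at most `γ`, and
  -- also `ε ‖T⁻¹‖ < 1`.
  set ε : ℝ≥0 := m / (⟨a, ha⟩ + N + 1) with hε
  have hεeq : (ε : ℝ) * (a + N + 1) = m := by
    rw [hε]
    push_cast
    exact div_mul_cancel₀ _ (by positivity)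
  have hε0 : 0 < ε := div_pos hm0 (by positivity)
  have hε0' : (0 : ℝ) < ε := hε0
  have hN0 : (0 : ℝ) ≤ N := N.2
  have hεa : a * ε ≤ m := by nlinarith
  refine ⟨ε, hε0, fun φ hφ hLip => ?_⟩
  obtain ⟨h, h1, h2⟩ := hA.exists_conj hLip (hεa.trans hm2) (by
    rcases subsingleton_or_nontrivial E with hE | hE
    · exact Or.inl hE
    · right
      have hNpos : 0 < N := by
        rw [hN, nnnorm_pos]
        intro h0
        obtain ⟨x, hx⟩ := exists_ne (0 : E)
        apply hx
        rw [← T.apply_symm_apply x, ← T.symm.coe_coe, h0]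
        simp
      rw [lt_inv_comm₀ hε0 hNpos, lt_inv_comm₀ hNpos hε0, ← one_div, lt_div_iff₀ hNpos]
      have : (ε : ℝ) * N < 1 := by nlinarith
      exact_mod_cast this)
  refine ⟨h, h1, fun x => (h2 x).trans (le_trans ?_ (hεa.trans hmγ))⟩
  gcongr

end IsGreenKernel

end StructuralStability

/-! ### Exponential dichotomy of a single orbit -/

section Dichotomy

theorem Int.exists_forall_succ_sub_eq (d : ℤ → ℝ) : ∃ s : ℤ → ℝ, ∀ n, s (n + 1) - s n = d n := by
  refine ⟨fun n => ∑ i ∈ Finset.range n.toNat, d i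
    - ∑ i ∈ Finset.range (-n).toNat, d (-(i + 1)), fun n => ?_⟩
  rcases le_or_gt 0 n with hn | hn
  · lift n to ℕ using hn
    have h1 : (-((n : ℤ) + 1)).toNat = 0 := by lia
    have h2 : (-(n : ℤ)).toNat = 0 := by lia
    have h3 : ((n : ℤ) + 1).toNat = n + 1 := by lia
    simp only [h1, h2, h3, Int.toNat_natCast, Finset.sum_range_succ, Finset.range_zero,
      Finset.sum_empty]
    ring
  · obtain ⟨m, rfl⟩ : ∃ m : ℕ, n = -(m + 1) := ⟨(-n - 1).toNat, by lia⟩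
    have h1 : (-(-((m : ℤ) + 1) + 1)).toNat = m := by lia
    have h2 : (-(-((m : ℤ) + 1))).toNat = m + 1 := by lia
    have h3 : (-((m : ℤ) + 1) + 1).toNat = 0 := by lia
    have h4 : (-((m : ℤ) + 1)).toNat = 0 := by lia
    simp only [h1, h2, h3, h4, Finset.sum_range_succ, Finset.range_zero, Finset.sum_empty]
    ring

/-- If a two-sided sequence is dominated by its increments, then the increments grow exponentially
to the right wherever the sequence is positive and to the left wherever it is nonpositive. -/
theorem exists_exponential_growth {s d : ℤ → ℝ} {C R : ℝ} (hC : 0 < C) (hR : 0 ≤ R)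
    (hd : ∀ n, 0 < d n) (hs : ∀ n, s (n + 1) - s n = d (n + 1)) (hsd : ∀ n, |s n| ≤ C * d n)
    (hdR : ∀ n, d n ≤ R * d (n + 1)) :
    ∃ K r : ℝ, 0 ≤ K ∧ 0 < r ∧ r < 1 ∧
      (∀ n, 0 < s n → ∀ j : ℕ, d n ≤ K * r ^ j * d (n + j)) ∧
      (∀ n, s n ≤ 0 → ∀ j : ℕ, d n ≤ K * r ^ j * d (n - j)) := by
  set r := C / (1 + C) with hr
  have hr0 : 0 < r := by positivity
  have hr1 : r < 1 := (div_lt_one (by positivity)).2 (by linarith)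
  have hpos : ∀ n, 0 < s n → 0 < s (n + 1) := fun n hn => by linarith [hs n, hd (n + 1)]
  have hposj : ∀ n, 0 < s n → ∀ j : ℕ, 0 < s (n + j) ∧ s n ≤ r ^ j * s (n + j) := by
    intro n hn j
    induction j with
    | zero => simpa using hn
    | succ j ih =>
      have h1 := hpos _ ih.1
      rw [Nat.cast_succ, ← add_assoc]
      refine ⟨h1, ih.2.trans ?_⟩
      rw [pow_succ, mul_assoc]
      refine mul_le_mul_of_nonneg_left ?_ (by positivity)
      have h2 := hsd (n + j + 1)
      rw [abs_of_pos h1, ← hs] at h2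
      have h3 := hs (n + j)
      have h4 := hd (n + j + 1)
      -- A rearrangement of `s (m+1) ≤ C (s (m+1) - s m)` with `m = n + j`; this is where the ratio
      -- `C / (1 + C)` comes from.
      have h5 : (1 + C) * s (n + j) ≤ C * s (n + j + 1) := by nlinarith
      rw [hr, div_mul_eq_mul_div, le_div_iff₀ (by positivity)]
      linarith
  have hneg : ∀ n, s n ≤ 0 → s (n - 1) ≤ 0 ∧ -s n ≤ r * -s (n - 1) := by
    intro n hn
    have h1 := hs (n - 1)
    rw [sub_add_cancel] at h1
    have h2 := hd n
    have h3 := hsd n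
    rw [abs_of_nonpos hn, ← h1] at h3
    refine ⟨by linarith, ?_⟩
    rw [hr, div_mul_eq_mul_div, le_div_iff₀ (by positivity)]
    nlinarith
  have hnegj : ∀ n, s n ≤ 0 → ∀ j : ℕ, s (n - j) ≤ 0 ∧ -s n ≤ r ^ j * -s (n - j) := by
    intro n hn j
    induction j with
    | zero => simpa using hn
    | succ j ih =>
      have h1 := hneg _ ih.1
      rw [Nat.cast_succ, ← sub_sub]
      refine ⟨h1.1, ih.2.trans ?_⟩
      rw [pow_succ, mul_assoc]
      exact mul_le_mul_of_nonneg_left h1.2 (by positivity)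
  -- The summand `1` in the constant covers `j = 0`; the division by `r` pays for the one step lost
  -- when `j` is positive.
  have hK : ∀ j : ℕ, (R + 1) * C * r ^ j ≤ (1 + (R + 1) * C / r) * r ^ (j + 1) := by
    intro j
    rw [pow_succ', ← mul_assoc]
    refine mul_le_mul_of_nonneg_right ?_ (by positivity)
    rw [add_mul 1, div_mul_cancel₀ _ hr0.ne']
    linarith
  refine ⟨1 + (R + 1) * C / r, r, by positivity, hr0, hr1, fun n hn j => ?_, fun n hn j => ?_⟩
  · rcases j with _ | j
    · have := hd n
      have h2 : 0 ≤ (R + 1) * C / r := by positivity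
      simp only [pow_zero, mul_one, Nat.cast_zero, add_zero]
      nlinarith
    -- Positivity of `s n` bounds `d (n+1)`, not `d n`, by `s (n+1)`; the hypothesis `hdR` bridges
    -- the gap. The backward case needs no such step, since `d n = s n - s (n-1) ≤ -s (n-1)`.
    · have h1 := hposj _ (hpos n hn) j
      have h2 := hsd (n + 1 + j)
      rw [abs_of_pos h1.1] at h2
      have e : n + ((j + 1 : ℕ) : ℤ) = n + 1 + j := by push_cast; ring
      rw [e]
      calc d n ≤ R * d (n + 1) := hdR n
        _ ≤ (R + 1) * s (n + 1) := by nlinarith [hs n, hd (n + 1)]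
        _ ≤ (R + 1) * (r ^ j * (C * d (n + 1 + j))) := by
          gcongr
          exact h1.2.trans (by gcongr)
        _ = (R + 1) * C * r ^ j * d (n + 1 + j) := by ring
        _ ≤ _ := mul_le_mul_of_nonneg_right (hK j) (hd _).le
  · rcases j with _ | j
    · have := hd n
      have h2 : 0 ≤ (R + 1) * C / r := by positivity
      simp only [pow_zero, mul_one, Nat.cast_zero, sub_zero]
      nlinarith
    · have h1 := hnegj _ (hneg n hn).1 j
      have h2 := hsd (n - 1 - j)
      rw [abs_of_nonpos h1.1] at h2
      have h3 := hs (n - 1)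
      rw [sub_add_cancel] at h3
      have e : n - ((j + 1 : ℕ) : ℤ) = n - 1 - j := by push_cast; ring
      rw [e]
      calc d n ≤ 1 * -s (n - 1) := by linarith
        _ ≤ (R + 1) * (r ^ j * (C * d (n - 1 - j))) := by
          refine mul_le_mul (by linarith) (h1.2.trans (by gcongr)) ?_ (by positivity)
          linarith [(hneg n hn).1]
        _ = (R + 1) * C * r ^ j * d (n - 1 - j) := by ring
        _ ≤ _ := mul_le_mul_of_nonneg_right (hK j) (hd _).le

variable {E : Type*} [NormedAddCommGroup E] [NormedSpace ℂ E]

/-- For an operator with the shadowing property, an orbit whose coordinate functional is uniformly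
bounded along the orbit decays exponentially forward on an up-set of times, and backward on the
complement. -/
theorem HasShadowingProperty.exists_orbit_dichotomy {T : E ≃L[ℂ] E} (hT : HasShadowingProperty T)
    {e : E} (ℓ : E →ₗ[ℂ] ℂ) (he : ℓ e = 1) {C : ℝ}
    (hℓ : ∀ (n : ℤ) (x : E), ‖ℓ ((T ^ (-n)) x)‖ * ‖(T ^ n) e‖ ≤ C * ‖x‖) :
    ∃ (A : Set ℤ) (K r : ℝ), (∀ n ∈ A, n + 1 ∈ A) ∧ 0 ≤ K ∧ 0 < r ∧ r < 1 ∧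
      (∀ n ∈ A, ∀ j : ℕ, ‖(T ^ (n + j)) e‖ ≤ K * r ^ j * ‖(T ^ n) e‖) ∧
      (∀ n ∉ A, ∀ j : ℕ, ‖(T ^ (n - j)) e‖ ≤ K * r ^ j * ‖(T ^ n) e‖) := by
  -- Shadowing at the single scale `1` suffices, by linearity.
  obtain ⟨δ, hδ, hshadow⟩ := hT 1 one_pos
  have he0 : e ≠ 0 := by
    rintro rfl
    simp at he
  set v : ℤ → ℝ := fun n => ‖(T ^ n) e‖ with hv
  have hv0 : ∀ n, 0 < v n := fun n => by
    rw [hv, norm_pos_iff, ne_eq, EmbeddingLike.map_eq_zero_iff]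
    exact he0
  obtain ⟨σ, hσ⟩ := Int.exists_forall_succ_sub_eq fun n => δ / v (n + 1)
  -- The error at time `n` is `(σ (n+1) - σ n) ‖T^(n+1) e‖ = δ`.
  obtain ⟨y, hy⟩ := hshadow (fun n => (σ n : ℂ) • (T ^ n) e) fun n => by
    rw [map_smul, ← T.zpow_add_one_apply, norm_sub_rev, ← sub_smul, norm_smul, ← Complex.ofReal_sub,
      Complex.norm_real, hσ, Real.norm_of_nonneg (div_pos hδ (hv0 _)).le]
    exact (div_mul_cancel₀ _ (hv0 _).ne').le
  set s : ℤ → ℝ := fun n => σ n - (ℓ y).re with hs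
  have hs1 : ∀ n, |s n| ≤ C / δ * (δ / v n) := fun n => by
    have h1 : ℓ ((T ^ (-n)) ((σ n : ℂ) • (T ^ n) e - (T ^ n) y)) = (σ n : ℂ) - ℓ y := by
      rw [map_sub, map_smul, T.zpow_neg_apply_zpow, T.zpow_neg_apply_zpow, map_sub, map_smul, he,
        smul_eq_mul, mul_one]
    have h2 := hℓ n ((σ n : ℂ) • (T ^ n) e - (T ^ n) y)
    rw [h1] at h2
    have h3 : |s n| ≤ ‖(σ n : ℂ) - ℓ y‖ := by
      have := Complex.abs_re_le_norm ((σ n : ℂ) - ℓ y)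
      rwa [Complex.sub_re, Complex.ofReal_re] at this
    have hC0 : 0 ≤ C := by
      have h4 := hℓ 0 e
      have h5 : 0 ≤ C * ‖e‖ := le_trans (by positivity) h4
      exact nonneg_of_mul_nonneg_left h5 (norm_pos_iff.2 he0)
    have h6 : C * ‖(σ n : ℂ) • (T ^ n) e - (T ^ n) y‖ ≤ C := by
      rw [norm_sub_rev]
      exact mul_le_of_le_one_right hC0 (hy n).le
    rw [div_mul_div_cancel₀ hδ.ne', le_div_iff₀ (hv0 n)]
    exact (mul_le_mul_of_nonneg_right h3 (hv0 n).le).trans (h2.trans h6)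
  -- The maximum with `1` only makes the domination constant strictly positive.
  obtain ⟨K, r, hK, hr0, hr1, hfw, hbw⟩ := exists_exponential_growth (s := s)
    (d := fun n => δ / v n) (C := max (C / δ) 1) (R := ‖(T : E →L[ℂ] E)‖) (by positivity)
    (norm_nonneg _) (fun n => div_pos hδ (hv0 n))
    (fun n => by rw [hs, sub_sub_sub_cancel_right, hσ])
    (fun n => (hs1 n).trans (mul_le_mul_of_nonneg_right (le_max_left _ _)
      (div_pos hδ (hv0 n)).le))
    (fun n => by
      rw [mul_div_assoc', div_le_div_iff₀ (hv0 _) (hv0 _), mul_comm _ δ, mul_assoc]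
      refine mul_le_mul_of_nonneg_left ?_ hδ.le
      change ‖(T ^ (n + 1)) e‖ ≤ _
      rw [T.zpow_add_one_apply]
      exact (T : E →L[ℂ] E).le_opNorm _)
  have key : ∀ m n : ℤ, ∀ c : ℝ, δ / v n ≤ c * (δ / v m) → v m ≤ c * v n := fun m n c h => by
    rw [mul_div_assoc', div_le_div_iff₀ (hv0 _) (hv0 _), mul_right_comm, mul_comm δ] at h
    exact le_of_mul_le_mul_right h hδ
  refine ⟨{n | 0 < s n}, K, r, fun n hn => ?_, hK, hr0, hr1, fun n hn j => key _ _ _ (hfw n hn j),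
    fun n hn j => key _ _ _ (hbw n (not_lt.1 hn) j)⟩
  have h1 := hσ n
  have h2 := div_pos hδ (hv0 (n + 1))
  change 0 < σ n - (ℓ y).re at hn
  change 0 < σ (n + 1) - (ℓ y).re
  linarith

end Dichotomy

/-! ### Integer iterates of an invertible measurable map -/

section Iterates

variable {X : Type*} [MeasurableSpace X]

/-- The iterate `f ^ n`, `n ∈ ℤ`, of an invertible measurable map, as a function. -/
def zpowIterate (f : X ≃ᵐ X) (n : ℤ) : X → X := ((f.toEquiv : Equiv.Perm X) ^ n : Equiv.Perm X)

theorem zpowIterate_zero (f : X ≃ᵐ X) : zpowIterate f 0 = id := rfl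

theorem zpowIterate_add (f : X ≃ᵐ X) (m n : ℤ) :
    zpowIterate f (m + n) = zpowIterate f m ∘ zpowIterate f n := by
  rw [zpowIterate, zpow_add]
  rfl

theorem zpowIterate_one (f : X ≃ᵐ X) : zpowIterate f 1 = f := by
  rw [zpowIterate, zpow_one]
  rfl

theorem zpowIterate_neg_one (f : X ≃ᵐ X) : zpowIterate f (-1) = f.symm := by
  rw [zpowIterate, zpow_neg_one]
  rfl

theorem zpowIterate_add_one (f : X ≃ᵐ X) (n : ℤ) :
    zpowIterate f (n + 1) = zpowIterate f n ∘ f := by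
  rw [zpowIterate_add, zpowIterate_one]

theorem zpowIterate_sub_one (f : X ≃ᵐ X) (n : ℤ) :
    zpowIterate f (n - 1) = zpowIterate f n ∘ f.symm := by
  rw [sub_eq_add_neg, zpowIterate_add, zpowIterate_neg_one]

theorem preimage_zpowIterate_preimage (f : X ≃ᵐ X) (m n : ℤ) (B : Set X) :
    zpowIterate f n ⁻¹' (zpowIterate f m ⁻¹' B) = zpowIterate f (m + n) ⁻¹' B := by
  rw [zpowIterate_add, Set.preimage_comp]

theorem iterImage_eq_preimage (f : X ≃ᵐ X) (k : ℤ) (B : Set X) :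
    iterImage f k B = zpowIterate f (-k) ⁻¹' B := by
  rw [iterImage, Equiv.image_eq_preimage_symm, zpowIterate, zpow_neg]
  rfl

theorem zpowIterate_induction (f : X ≃ᵐ X) {P : (X → X) → Prop} (h0 : P id)
    (hf : ∀ g, P g → P (g ∘ f)) (hf' : ∀ g, P g → P (g ∘ f.symm)) (n : ℤ) :
    P (zpowIterate f n) := by
  induction n with
  | zero => exact h0
  | succ n ih => exact zpowIterate_add_one f n ▸ hf _ ih
  | pred n ih => exact zpowIterate_sub_one f (-n) ▸ hf' _ ih

theorem measurable_zpowIterate (f : X ≃ᵐ X) (n : ℤ) : Measurable (zpowIterate f n) :=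
  zpowIterate_induction f measurable_id (fun _ h => h.comp f.measurable)
    (fun _ h => h.comp f.symm.measurable) n

end Iterates

/-! ### Decomposition of the space into pieces `f^(-n) W` -/

namespace IsDissipativeSystem

variable {X : Type*} [MeasurableSpace X] {μ : Measure X} {f : X ≃ᵐ X} {W : Set X}

theorem quasiMeasurePreserving (hW : IsDissipativeSystem μ f W) :
    Measure.QuasiMeasurePreserving f μ μ :=
  ⟨f.measurable, Measure.AbsolutelyContinuous.mk fun B hB h => by
    rw [Measure.map_apply f.measurable hB]
    exact (hW.nonsingular B hB).2 h⟩

theorem quasiMeasurePreserving_symm (hW : IsDissipativeSystem μ f W) :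
    Measure.QuasiMeasurePreserving f.symm μ μ :=
  ⟨f.symm.measurable, Measure.AbsolutelyContinuous.mk fun B hB h => by
    rw [Measure.map_apply f.symm.measurable hB, ← hW.nonsingular _ (f.symm.measurable hB),
      ← Set.preimage_comp]
    simpa using h⟩

theorem quasiMeasurePreserving_zpowIterate (hW : IsDissipativeSystem μ f W) (n : ℤ) :
    Measure.QuasiMeasurePreserving (zpowIterate f n) μ μ :=
  zpowIterate_induction f (P := fun g => Measure.QuasiMeasurePreserving g μ μ)
    (Measure.QuasiMeasurePreserving.id μ) (fun _ h => h.comp hW.quasiMeasurePreserving)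
    (fun _ h => h.comp hW.quasiMeasurePreserving_symm) n

theorem measurableSet_preimage (hW : IsDissipativeSystem μ f W) (n : ℤ) :
    MeasurableSet (zpowIterate f n ⁻¹' W) := measurable_zpowIterate f n hW.measurableSet

theorem disjoint_preimage (hW : IsDissipativeSystem μ f W) :
    Pairwise fun m n : ℤ => Disjoint (zpowIterate f m ⁻¹' W) (zpowIterate f n ⁻¹' W) := by
  intro m n hmn
  have : Disjoint (iterImage f (-m) W) (iterImage f (-n) W) :=
    hW.pairwise_disjoint (neg_injective.ne hmn)
  rwa [iterImage_eq_preimage, iterImage_eq_preimage, neg_neg, neg_neg] at this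

theorem exists_mem_preimage (hW : IsDissipativeSystem μ f W) (x : X) :
    ∃ n : ℤ, x ∈ zpowIterate f n ⁻¹' W := by
  have : x ∈ ⋃ k : ℤ, iterImage f k W := hW.iUnion_eq ▸ Set.mem_univ x
  obtain ⟨k, hk⟩ := Set.mem_iUnion.1 this
  exact ⟨-k, iterImage_eq_preimage f k W ▸ hk⟩

theorem measure_preimage_ne_zero (hW : IsDissipativeSystem μ f W) (n : ℤ) :
    μ (zpowIterate f n ⁻¹' W) ≠ 0 := fun h => by
  have := (hW.quasiMeasurePreserving_zpowIterate (-n)).preimage_null h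
  rw [preimage_zpowIterate_preimage, add_neg_cancel, zpowIterate_zero] at this
  exact hW.measure_pos.ne' this

/-- The union of the pieces of a dissipative system indexed by a set of times. -/
def piece (f : X ≃ᵐ X) (W : Set X) (A : Set ℤ) : Set X := ⋃ n ∈ A, zpowIterate f n ⁻¹' W

theorem measurableSet_piece (hW : IsDissipativeSystem μ f W) (A : Set ℤ) :
    MeasurableSet (piece f W A) :=
  MeasurableSet.biUnion A.to_countable fun n _ => hW.measurableSet_preimage n

theorem compl_piece (hW : IsDissipativeSystem μ f W) (A : Set ℤ) :
    (piece f W A)ᶜ = piece f W Aᶜ := by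
  ext x
  simp only [piece, Set.mem_compl_iff, Set.mem_iUnion, exists_prop, not_exists, not_and]
  constructor
  · intro h
    obtain ⟨n, hn⟩ := hW.exists_mem_preimage x
    exact ⟨n, fun hA => h n hA hn, hn⟩
  · rintro ⟨n, hn, hx⟩ m hm hxm
    refine (hW.disjoint_preimage (i := m) (j := n) ?_).le_bot ⟨hxm, hx⟩
    rintro rfl
    exact hn hm

theorem preimage_piece (f : X ≃ᵐ X) (W : Set X) (A : Set ℤ) (m : ℤ) :
    zpowIterate f m ⁻¹' piece f W A = piece f W ((· - m) ⁻¹' A) := by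
  ext x
  simp only [piece, Set.preimage_iUnion, Set.mem_iUnion, exists_prop, Set.mem_preimage,
    ← Function.comp_apply (f := zpowIterate f _) (g := zpowIterate f m), ← zpowIterate_add]
  constructor
  · rintro ⟨n, hn, hx⟩
    exact ⟨n + m, by simpa using hn, hx⟩
  · rintro ⟨n, hn, hx⟩
    exact ⟨n - m, hn, by simpa using hx⟩

theorem piece_mono (f : X ≃ᵐ X) (W : Set X) {A B : Set ℤ} (h : A ⊆ B) :
    piece f W A ⊆ piece f W B := Set.biUnion_subset_biUnion_left h

end IsDissipativeSystem

/-! ### Consequences of bounded distortion -/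

section Distortion

variable {X : Type*} [MeasurableSpace X] {μ : Measure X} {f : X ≃ᵐ X} {W : Set X}

/-- The bounded distortion inequalities with constant `K`, in terms of preimages. -/
def HasDistortion (μ : Measure X) (f : X ≃ᵐ X) (W : Set X) (K : ℝ≥0∞) : Prop :=
  ∀ (n : ℤ) (B : Set X), MeasurableSet B → B ⊆ W →
    μ (zpowIterate f n ⁻¹' W) * μ B ≤ K * (μ (zpowIterate f n ⁻¹' B) * μ W) ∧
    μ (zpowIterate f n ⁻¹' B) * μ W ≤ K * (μ (zpowIterate f n ⁻¹' W) * μ B)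

theorem IsDissipativeSystemOfBoundedDistortion.exists_hasDistortion
    (hW : IsDissipativeSystemOfBoundedDistortion μ f W) :
    ∃ K : ℝ≥0, HasDistortion μ f W K := by
  obtain ⟨K, hK, h⟩ := hW.bounded_distortion
  refine ⟨K, fun n B hB hBW => ?_⟩
  have := h (-n) B hB hBW
  rw [iterImage_eq_preimage, iterImage_eq_preimage, neg_neg] at this
  refine ⟨?_, this.2⟩
  exact (ENNReal.inv_mul_le_iff (by exact_mod_cast hK.ne') ENNReal.coe_ne_top).1 this.1

namespace HasDistortion

variable {K : ℝ≥0∞}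

/-- Both `B` and `f^(-j) B` are iterated preimages of the set `f^n B ⊆ W`. Comparing each with it
costs one factor `K`. -/
theorem measure_preimage_mul_le (hK : HasDistortion μ f W K) (hW : IsDissipativeSystem μ f W)
    (n j : ℤ) {B : Set X} (hB : MeasurableSet B) (hBn : B ⊆ zpowIterate f n ⁻¹' W) :
    μ (zpowIterate f j ⁻¹' B) * μ (zpowIterate f n ⁻¹' W)
      ≤ K * K * (μ (zpowIterate f (n + j) ⁻¹' W) * μ B) := by
  set B₀ := zpowIterate f (-n) ⁻¹' B with hB₀
  have h1 : zpowIterate f n ⁻¹' B₀ = B := by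
    rw [hB₀, preimage_zpowIterate_preimage, neg_add_cancel, zpowIterate_zero, Set.preimage_id]
  have h2 : zpowIterate f (n + j) ⁻¹' B₀ = zpowIterate f j ⁻¹' B := by
    rw [hB₀, preimage_zpowIterate_preimage, neg_add_cancel_left]
  have h3 : B₀ ⊆ W := by
    have := Set.preimage_mono (f := zpowIterate f (-n)) hBn
    rwa [preimage_zpowIterate_preimage, add_neg_cancel, zpowIterate_zero, Set.preimage_id] at this
  have hB₀m : MeasurableSet B₀ := measurable_zpowIterate f (-n) hB
  have h4 := (hK n B₀ hB₀m h3).1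
  have h5 := (hK (n + j) B₀ hB₀m h3).2
  rw [h1] at h4
  rw [h2] at h5
  rw [← ENNReal.mul_le_mul_iff_left hW.measure_pos.ne' hW.measure_lt_top.ne]
  calc μ (zpowIterate f j ⁻¹' B) * μ (zpowIterate f n ⁻¹' W) * μ W
      = μ (zpowIterate f j ⁻¹' B) * μ W * μ (zpowIterate f n ⁻¹' W) := by ring
    _ ≤ K * (μ (zpowIterate f (n + j) ⁻¹' W) * μ B₀) * μ (zpowIterate f n ⁻¹' W) := by gcongr
    _ = K * μ (zpowIterate f (n + j) ⁻¹' W) * (μ (zpowIterate f n ⁻¹' W) * μ B₀) := by ring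
    _ ≤ K * μ (zpowIterate f (n + j) ⁻¹' W) * (K * (μ B * μ W)) := by gcongr
    _ = _ := by ring

/-- A bound for the measures of the iterates of the generating set transfers to all measurable
subsets of the corresponding union of pieces. -/
theorem measure_preimage_le (hK : HasDistortion μ f W K) (hW : IsDissipativeSystem μ f W)
    (hfin : ∀ n : ℤ, μ (zpowIterate f n ⁻¹' W) ≠ ∞) {A : Set ℤ} {j : ℤ} {c : ℝ≥0∞}
    (hc : ∀ n ∈ A, μ (zpowIterate f (n + j) ⁻¹' W) ≤ c * μ (zpowIterate f n ⁻¹' W))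
    {B : Set X} (hB : MeasurableSet B) (hBA : B ⊆ IsDissipativeSystem.piece f W A) :
    μ (zpowIterate f j ⁻¹' B) ≤ K * K * c * μ B := by
  have hunion : B = ⋃ n : ℤ, B ∩ zpowIterate f n ⁻¹' W := by
    rw [← Set.inter_iUnion]
    refine (Set.inter_eq_left.2 fun x _ => ?_).symm
    exact Set.mem_iUnion.2 (hW.exists_mem_preimage x)
  have hm : ∀ n : ℤ, MeasurableSet (B ∩ zpowIterate f n ⁻¹' W) := fun n =>
    hB.inter (hW.measurableSet_preimage n)
  have hd : Pairwise fun m n : ℤ =>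
      Disjoint (B ∩ zpowIterate f m ⁻¹' W) (B ∩ zpowIterate f n ⁻¹' W) := fun m n hmn =>
    (hW.disjoint_preimage hmn).mono Set.inter_subset_right Set.inter_subset_right
  have hpiece : ∀ n : ℤ, μ (zpowIterate f j ⁻¹' (B ∩ zpowIterate f n ⁻¹' W))
      ≤ K * K * c * μ (B ∩ zpowIterate f n ⁻¹' W) := by
    intro n
    by_cases hn : n ∈ A
    · rw [← ENNReal.mul_le_mul_iff_left (hW.measure_preimage_ne_zero n) (hfin n)]
      refine (hK.measure_preimage_mul_le hW n j (hm n) Set.inter_subset_right).trans ?_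
      calc K * K * (μ (zpowIterate f (n + j) ⁻¹' W) * μ (B ∩ zpowIterate f n ⁻¹' W))
          ≤ K * K * (c * μ (zpowIterate f n ⁻¹' W) * μ (B ∩ zpowIterate f n ⁻¹' W)) := by
            gcongr
            exact hc n hn
        _ = _ := by ring
    · have : B ∩ zpowIterate f n ⁻¹' W = ∅ := by
        refine Set.eq_empty_of_forall_notMem fun x hx => ?_
        obtain ⟨m, hmA, hxm⟩ := Set.mem_iUnion₂.1 (hBA hx.1)
        refine (hW.disjoint_preimage (i := m) (j := n) ?_).le_bot ⟨hxm, hx.2⟩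
        rintro rfl
        exact hn hmA
      simp [this]
  calc μ (zpowIterate f j ⁻¹' B)
      = μ (⋃ n : ℤ, zpowIterate f j ⁻¹' (B ∩ zpowIterate f n ⁻¹' W)) := by
        rw [← Set.preimage_iUnion, ← hunion]
    _ ≤ ∑' n : ℤ, μ (zpowIterate f j ⁻¹' (B ∩ zpowIterate f n ⁻¹' W)) := measure_iUnion_le _
    _ ≤ ∑' n : ℤ, K * K * c * μ (B ∩ zpowIterate f n ⁻¹' W) := ENNReal.tsum_le_tsum hpiece
    _ = K * K * c * μ B := by
        rw [ENNReal.tsum_mul_left, ← measure_iUnion hd hm, ← hunion]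

end HasDistortion

end Distortion

/-! ### Norm estimates for powers of the composition operator -/

section CompositionOperator

variable {X : Type*} [MeasurableSpace X] {μ : Measure X} {f : X ≃ᵐ X} {W : Set X}
  {p : ℝ≥0∞} [Fact (1 ≤ p)] {T : Lp ℂ p μ ≃L[ℂ] Lp ℂ p μ}

theorem zpow_coeFn_ae_eq (hW : IsDissipativeSystem μ f W) (hT : ∀ g, T g =ᵐ[μ] g ∘ f) (n : ℤ)
    (g : Lp ℂ p μ) : (T ^ n) g =ᵐ[μ] g ∘ zpowIterate f n := by
  induction n with
  | zero => exact ae_eq_rfl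
  | succ n ih =>
    rw [T.zpow_add_one_apply, zpowIterate_add_one]
    exact (hT _).trans (hW.quasiMeasurePreserving.ae_eq_comp ih)
  | pred n ih =>
    have h1 : T ((T ^ (-(n : ℤ) - 1)) g) = (T ^ (-(n : ℤ))) g := by
      rw [← T.zpow_add_one_apply, sub_add_cancel]
    have h2 := hT ((T ^ (-(n : ℤ) - 1)) g)
    rw [h1] at h2
    have h3 := hW.quasiMeasurePreserving_symm.ae_eq_comp (h2.symm.trans ih)
    rw [zpowIterate_sub_one]
    refine EventuallyEq.trans (EventuallyEq.of_eq ?_) h3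
    ext x
    simp

variable (hW : IsDissipativeSystem μ f W) (hT : ∀ g, T g =ᵐ[μ] g ∘ f)
include hW hT

theorem eLpNorm_zpow (n : ℤ) (g : Lp ℂ p μ) :
    eLpNorm ((T ^ n) g) p μ = eLpNorm g p (μ.map (zpowIterate f n)) := by
  have hq := hW.quasiMeasurePreserving_zpowIterate n
  rw [eLpNorm_congr_ae (zpow_coeFn_ae_eq hW hT n g), eLpNorm_map_measure
    ((Lp.aestronglyMeasurable g).mono_ac hq.absolutelyContinuous) hq.measurable.aemeasurable]

theorem zpow_indicatorConstLp_ae_eq (n : ℤ) :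
    (T ^ n) (indicatorConstLp p hW.measurableSet hW.measure_lt_top.ne (1 : ℂ))
      =ᵐ[μ] (zpowIterate f n ⁻¹' W).indicator fun _ => 1 :=
  (zpow_coeFn_ae_eq hW hT n _).trans
    ((hW.quasiMeasurePreserving_zpowIterate n).ae_eq_comp indicatorConstLp_coeFn)

theorem enorm_zpow_indicatorConstLp (hp : p ≠ ∞) (n : ℤ) :
    ‖(T ^ n) (indicatorConstLp p hW.measurableSet hW.measure_lt_top.ne (1 : ℂ))‖ₑ
      = μ (zpowIterate f n ⁻¹' W) ^ (1 / p.toReal) := by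
  rw [Lp.enorm_def, eLpNorm_congr_ae (zpow_indicatorConstLp_ae_eq hW hT n),
    eLpNorm_indicator_const (hW.measurableSet_preimage n)
      (zero_lt_one.trans_le (Fact.out : 1 ≤ p)).ne' hp]
  simp

/-- Finiteness holds because `T^n` keeps the indicator of `W` in `L^p`; for negative `n` this rests
on the invertibility of `T`. -/
theorem measure_preimage_ne_top (hp : p ≠ ∞) (n : ℤ) : μ (zpowIterate f n ⁻¹' W) ≠ ∞ := by
  have hp0 : 0 < 1 / p.toReal := one_div_pos.2
    (ENNReal.toReal_pos (zero_lt_one.trans_le (Fact.out : 1 ≤ p)).ne' hp)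
  intro h
  have := enorm_zpow_indicatorConstLp hW hT hp n
  rw [h, ENNReal.top_rpow_of_pos hp0] at this
  exact enorm_ne_top this

/-- On functions supported in a union of pieces, the powers of the composition operator are
controlled by their action on the indicator of the generating set. -/
theorem norm_zpow_le_of_ae_eq_zero {K : ℝ≥0} (hK : HasDistortion μ f W K) (hp : p ≠ ∞)
    {A : Set ℤ} {j : ℤ} {D : ℝ} (hD0 : 0 ≤ D)
    (hD : ∀ n ∈ A,
      ‖(T ^ (n + j)) (indicatorConstLp p hW.measurableSet hW.measure_lt_top.ne (1 : ℂ))‖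
        ≤ D * ‖(T ^ n) (indicatorConstLp p hW.measurableSet hW.measure_lt_top.ne (1 : ℂ))‖)
    (g : Lp ℂ p μ) (hg : g =ᵐ[μ.restrict (IsDissipativeSystem.piece f W A)ᶜ] 0) :
    ‖(T ^ j) g‖ ≤ ((K * K) ^ (1 / p.toReal) : ℝ≥0) * D * ‖g‖ := by
  have hp0 : 0 < p.toReal := ENNReal.toReal_pos (zero_lt_one.trans_le (Fact.out : 1 ≤ p)).ne' hp
  set Y := IsDissipativeSystem.piece f W A with hY
  have hYm : MeasurableSet Y := hW.measurableSet_piece A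
  lift D to ℝ≥0 using hD0
  have hc : ∀ n ∈ A, μ (zpowIterate f (n + j) ⁻¹' W)
      ≤ (D : ℝ≥0∞) ^ p.toReal * μ (zpowIterate f n ⁻¹' W) := by
    intro n hn
    have h1 : ‖(T ^ (n + j)) (indicatorConstLp p hW.measurableSet hW.measure_lt_top.ne (1 : ℂ))‖ₑ
        ≤ D * ‖(T ^ n) (indicatorConstLp p hW.measurableSet hW.measure_lt_top.ne (1 : ℂ))‖ₑ := by
      simp only [enorm_eq_nnnorm]
      exact_mod_cast hD n hn
    rw [enorm_zpow_indicatorConstLp hW hT hp, enorm_zpow_indicatorConstLp hW hT hp] at h1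
    have h2 := ENNReal.rpow_le_rpow h1 hp0.le
    rwa [ENNReal.mul_rpow_of_nonneg _ _ hp0.le, ← ENNReal.rpow_mul, ← ENNReal.rpow_mul,
      one_div_mul_cancel hp0.ne', ENNReal.rpow_one, ENNReal.rpow_one] at h2
  -- Controlling the pushforward on `Y` reduces the operator bound to a comparison of measures; the
  -- factor `D ^ p` becomes `D` after the `p`-th root.
  have hle : (μ.map (zpowIterate f j)).restrict Y
      ≤ ((K : ℝ≥0∞) * K * (D : ℝ≥0∞) ^ p.toReal) • μ := by
    refine Measure.le_iff.2 fun B hB => ?_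
    rw [Measure.restrict_apply hB, Measure.map_apply (measurable_zpowIterate f j) (hB.inter hYm),
      Measure.smul_apply, smul_eq_mul]
    refine (hK.measure_preimage_le hW (measure_preimage_ne_top hW hT hp) hc (hB.inter hYm)
      Set.inter_subset_right).trans ?_
    gcongr
    exact Set.inter_subset_left
  have hgY : Y.indicator g =ᵐ[μ] g := by
    have := (ae_restrict_iff' hYm.compl).1 hg
    filter_upwards [this] with x hx
    by_cases hxY : x ∈ Y
    · rw [Set.indicator_of_mem hxY]
    · rw [Set.indicator_of_notMem hxY, hx hxY]
      rfl
  have hmain : ‖(T ^ j) g‖ₑ ≤ ((K * K) ^ (1 / p.toReal) : ℝ≥0) * D * ‖g‖ₑ := by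
    rw [Lp.enorm_def, Lp.enorm_def, eLpNorm_zpow hW hT, ← eLpNorm_congr_ae
      ((hW.quasiMeasurePreserving_zpowIterate j).absolutelyContinuous.ae_eq hgY),
      eLpNorm_indicator_eq_eLpNorm_restrict hYm]
    refine (eLpNorm_le_of_measure_le_smul hle).trans (le_of_eq ?_)
    rw [smul_eq_mul, ENNReal.toReal_div, ENNReal.toReal_one,
      ENNReal.mul_rpow_of_nonneg _ _ (one_div_pos.2 hp0).le, ← ENNReal.rpow_mul,
      mul_one_div_cancel hp0.ne', ENNReal.rpow_one,
      ENNReal.coe_rpow_of_nonneg _ (one_div_pos.2 hp0).le, ENNReal.coe_mul]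
  simp only [enorm_eq_nnnorm] at hmain
  exact_mod_cast hmain

/-- The integral over the generating set, along the orbit of its indicator. -/
theorem exists_orbit_functional {K : ℝ≥0} (hK : HasDistortion μ f W K) (hp : p ≠ ∞) :
    ∃ (ℓ : Lp ℂ p μ →ₗ[ℂ] ℂ) (C : ℝ),
      ℓ (indicatorConstLp p hW.measurableSet hW.measure_lt_top.ne (1 : ℂ)) = 1 ∧
      ∀ (n : ℤ) (x : Lp ℂ p μ), ‖ℓ ((T ^ (-n)) x)‖ *
        ‖(T ^ n) (indicatorConstLp p hW.measurableSet hW.measure_lt_top.ne (1 : ℂ))‖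
          ≤ C * ‖x‖ := by
  have hp1 : 1 ≤ p := Fact.out
  have hp0 : 0 < p.toReal := ENNReal.toReal_pos (zero_lt_one.trans_le hp1).ne' hp
  have hp0' := (one_div_pos.2 hp0).le
  have hfinW : IsFiniteMeasure (μ.restrict W) := ⟨by simpa using hW.measure_lt_top⟩
  have hint : ∀ g : Lp ℂ p μ, Integrable g (μ.restrict W) := fun g =>
    ((Lp.memLp g).restrict W).integrable hp1
  set ℓ₀ : Lp ℂ p μ →ₗ[ℂ] ℂ :=
    { toFun := fun g => ∫ x in W, g x ∂μ
      map_add' := fun g h => by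
        rw [← integral_add (hint g) (hint h)]
        exact integral_congr_ae (ae_restrict_of_ae (Lp.coeFn_add g h))
      map_smul' := fun c g => by
        rw [RingHom.id_apply, ← integral_smul]
        exact integral_congr_ae (ae_restrict_of_ae (Lp.coeFn_smul c g)) }
  have hWr : (μ.real W : ℂ) ≠ 0 := by
    exact_mod_cast (ENNReal.toReal_pos hW.measure_pos.ne' hW.measure_lt_top.ne).ne'
  -- `L` is the Hölder constant for passing from the `L^1` to the `L^p` norm on `W`.
  set L : ℝ≥0∞ := μ W ^ (1 - 1 / p.toReal) with hL
  have hLfin : L ≠ ∞ := ENNReal.rpow_ne_top_of_nonneg' hW.measure_pos hW.measure_lt_top.ne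
  set C : ℝ≥0∞ := (K * μ W) ^ (1 / p.toReal) * L with hC
  have hCfin : C ≠ ∞ := ENNReal.mul_ne_top (ENNReal.rpow_ne_top_of_nonneg hp0'
    (ENNReal.mul_ne_top ENNReal.coe_ne_top hW.measure_lt_top.ne)) hLfin
  have hbound : ∀ (n : ℤ) (x : Lp ℂ p μ), ‖ℓ₀ ((T ^ (-n)) x)‖ₑ *
        ‖(T ^ n) (indicatorConstLp p hW.measurableSet hW.measure_lt_top.ne (1 : ℂ))‖ₑ
          ≤ C * ‖x‖ₑ := by
    intro n x
    have hq := hW.quasiMeasurePreserving_zpowIterate (-n)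
    have hVtop := measure_preimage_ne_top hW hT hp n
    have hV0 := hW.measure_preimage_ne_zero n
    set V := μ (zpowIterate f n ⁻¹' W) with hV
    -- The lower distortion inequality yields the factor `1 / V`, whose `p`-th root cancels `‖T^n e‖
    -- = V^(1/p)` and makes the bound uniform in `n`.
    have hle : (μ.restrict W).map (zpowIterate f (-n)) ≤ (K * μ W / V) • μ := by
      refine Measure.le_iff.2 fun B hB => ?_
      rw [Measure.map_apply hq.measurable hB, Measure.restrict_apply (hq.measurable hB),
        Measure.smul_apply, smul_eq_mul, ← ENNReal.mul_div_right_comm,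
        ENNReal.le_div_iff_mul_le (Or.inl hV0) (Or.inl hVtop), mul_comm]
      refine (hK n _ ((hq.measurable hB).inter hW.measurableSet) Set.inter_subset_right).1.trans ?_
      have : zpowIterate f n ⁻¹' (zpowIterate f (-n) ⁻¹' B ∩ W) ⊆ B := by
        rw [Set.preimage_inter, preimage_zpowIterate_preimage, neg_add_cancel, zpowIterate_zero]
        exact Set.inter_subset_left
      rw [mul_assoc, mul_comm (μ W)]
      gcongr
    have h1 : ‖ℓ₀ ((T ^ (-n)) x)‖ₑ ≤ eLpNorm ((T ^ (-n)) x) p (μ.restrict W) * L := by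
      have h2 : ‖ℓ₀ ((T ^ (-n)) x)‖ₑ ≤ eLpNorm ((T ^ (-n)) x) 1 (μ.restrict W) := by
        rw [eLpNorm_one_eq_lintegral_enorm]
        exact enorm_integral_le_lintegral_enorm _
      refine h2.trans ((eLpNorm_le_eLpNorm_mul_rpow_measure_univ hp1
        (Lp.aestronglyMeasurable _).restrict).trans (le_of_eq ?_))
      simp [hL]
    have h3 : eLpNorm ((T ^ (-n)) x) p (μ.restrict W)
        ≤ (K * μ W / V) ^ (1 / p.toReal) * ‖x‖ₑ := by
      have hac : (μ.restrict W).map (zpowIterate f (-n)) ≪ μ :=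
        Measure.absolutelyContinuous_of_le_smul hle
      rw [eLpNorm_congr_ae (ae_restrict_of_ae (zpow_coeFn_ae_eq hW hT (-n) x)),
        ← eLpNorm_map_measure ((Lp.aestronglyMeasurable x).mono_ac hac)
          hq.measurable.aemeasurable, Lp.enorm_def]
      refine (eLpNorm_le_of_measure_le_smul hle).trans (le_of_eq ?_)
      rw [smul_eq_mul, ENNReal.toReal_div, ENNReal.toReal_one]
    rw [enorm_zpow_indicatorConstLp hW hT hp]
    calc ‖ℓ₀ ((T ^ (-n)) x)‖ₑ * V ^ (1 / p.toReal)
        ≤ (K * μ W / V) ^ (1 / p.toReal) * ‖x‖ₑ * L * V ^ (1 / p.toReal) := by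
          gcongr
          exact h1.trans (by gcongr)
      _ = ((K * μ W / V) ^ (1 / p.toReal) * V ^ (1 / p.toReal)) * L * ‖x‖ₑ := by ring
      _ = C * ‖x‖ₑ := by
          rw [← ENNReal.mul_rpow_of_nonneg _ _ hp0', ENNReal.div_mul_cancel hV0 hVtop]
  refine ⟨(μ.real W : ℂ)⁻¹ • ℓ₀, (μ.real W)⁻¹ * C.toReal, ?_, fun n x => ?_⟩
  · rw [LinearMap.smul_apply, smul_eq_mul]
    change _ * (∫ x in W, indicatorConstLp p hW.measurableSet hW.measure_lt_top.ne (1 : ℂ) x ∂μ) = 1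
    rw [setIntegral_indicatorConstLp hW.measurableSet, Set.inter_self, Complex.real_smul, mul_one,
      inv_mul_cancel₀ hWr]
  · have := ENNReal.toReal_mono (ENNReal.mul_ne_top hCfin enorm_ne_top) (hbound n x)
    rw [ENNReal.toReal_mul, ENNReal.toReal_mul, toReal_enorm, toReal_enorm, toReal_enorm] at this
    rw [LinearMap.smul_apply, norm_smul, norm_inv, Complex.norm_real,
      Real.norm_of_nonneg measureReal_nonneg, mul_assoc, mul_assoc]
    exact mul_le_mul_of_nonneg_left this (inv_nonneg.2 measureReal_nonneg)

end CompositionOperator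

/-! ### The invariant splitting by supports, and the main theorem -/

section Vanishing

variable {X : Type*} [MeasurableSpace X] {μ : Measure X} {p : ℝ≥0∞} [Fact (1 ≤ p)]

/-- The closed subspace of functions in `L^p` vanishing almost everywhere on a set. -/
noncomputable def lpVanishing (μ : Measure X) (p : ℝ≥0∞) [Fact (1 ≤ p)] (s : Set X) :
    Submodule ℂ (Lp ℂ p μ) := (LpToLpRestrictCLM X ℂ ℂ μ p s).ker

theorem mem_lpVanishing {s : Set X} {g : Lp ℂ p μ} :
    g ∈ lpVanishing μ p s ↔ g =ᵐ[μ.restrict s] 0 := by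
  rw [lpVanishing, LinearMap.mem_ker, ContinuousLinearMap.coe_coe, Lp.eq_zero_iff_ae_eq_zero]
  have h := LpToLpRestrictCLM_coeFn ℂ s g
  exact ⟨h.symm.trans, h.trans⟩

theorem isClosed_lpVanishing (s : Set X) : IsClosed (lpVanishing μ p s : Set (Lp ℂ p μ)) :=
  (LpToLpRestrictCLM X ℂ ℂ μ p s).isClosed_ker

theorem isCompl_lpVanishing {s : Set X} (hs : MeasurableSet s) :
    IsCompl (lpVanishing μ p sᶜ) (lpVanishing μ p s) := by
  refine IsCompl.of_eq ?_ ?_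
  · refine (Submodule.eq_bot_iff _).2 fun g hg => ?_
    rw [Submodule.mem_inf, mem_lpVanishing, mem_lpVanishing] at hg
    rw [Lp.eq_zero_iff_ae_eq_zero]
    filter_upwards [(ae_restrict_iff' hs.compl).1 hg.1, (ae_restrict_iff' hs).1 hg.2] with x h1 h2
    by_cases hx : x ∈ s
    · exact h2 hx
    · exact h1 hx
  · refine (Submodule.eq_top_iff').2 fun g => ?_
    have hmem : MemLp (s.indicator (g : X → ℂ)) p μ := (Lp.memLp g).indicator hs
    obtain ⟨g₁, hg₁⟩ : ∃ g₁ : Lp ℂ p μ, (g₁ : X → ℂ) =ᵐ[μ] s.indicator (g : X → ℂ) :=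
      ⟨hmem.toLp _, hmem.coeFn_toLp⟩
    refine Submodule.mem_sup.2 ⟨g₁, ?_, g - g₁, ?_, add_sub_cancel g₁ g⟩
    · rw [mem_lpVanishing]
      refine EventuallyEq.trans (ae_restrict_of_ae hg₁) ?_
      filter_upwards [ae_restrict_mem hs.compl] with x hx
      rw [Set.indicator_of_notMem hx]
      rfl
    · rw [mem_lpVanishing]
      refine EventuallyEq.trans (ae_restrict_of_ae (Lp.coeFn_sub _ _)) ?_
      filter_upwards [ae_restrict_of_ae hg₁, ae_restrict_mem hs] with x h1 hx
      rw [Pi.sub_apply, h1, Set.indicator_of_mem hx, sub_self]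
      rfl

theorem zpow_mem_lpVanishing {f : X ≃ᵐ X} {W : Set X} {T : Lp ℂ p μ ≃L[ℂ] Lp ℂ p μ}
    (hW : IsDissipativeSystem μ f W) (hT : ∀ g, T g =ᵐ[μ] g ∘ f) {s : Set X} (hs : MeasurableSet s)
    {n : ℤ} (hsn : s ⊆ zpowIterate f n ⁻¹' s) {g : Lp ℂ p μ} (hg : g ∈ lpVanishing μ p s) :
    (T ^ n) g ∈ lpVanishing μ p s := by
  rw [mem_lpVanishing] at hg ⊢
  refine EventuallyEq.trans (ae_restrict_of_ae (zpow_coeFn_ae_eq hW hT n g))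
    ((ae_restrict_iff' hs).2 ?_)
  filter_upwards [(hW.quasiMeasurePreserving_zpowIterate n).ae ((ae_restrict_iff' hs).1 hg)]
    with x hx hxs
  exact hx (hsn hxs)

/-- The splitting is by support: `M` lives on the pieces where the orbit of the indicator decays
forwards, `N` on those where it decays backwards. The up-set property of `A` gives the two one-sided
invariances. -/
theorem HasShadowingProperty.isGeneralizedHyperbolic_of_dissipative {f : X ≃ᵐ X} {W : Set X}
    {T : Lp ℂ p μ ≃L[ℂ] Lp ℂ p μ} (hshadow : HasShadowingProperty T) (hp : p ≠ ∞)
    (hBD : IsDissipativeSystemOfBoundedDistortion μ f W) (hT : ∀ g, T g =ᵐ[μ] g ∘ f) :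
    IsGeneralizedHyperbolic T := by
  have hW := hBD.toIsDissipativeSystem
  obtain ⟨K, hK⟩ := hBD.exists_hasDistortion
  obtain ⟨ℓ, C, hℓe, hℓ⟩ := exists_orbit_functional hW hT hK hp
  obtain ⟨A, D, r, hA, hD, hr0, hr1, hfw, hbw⟩ := hshadow.exists_orbit_dichotomy ℓ hℓe hℓ
  set Y := IsDissipativeSystem.piece f W A with hY
  have hYm : MeasurableSet Y := hW.measurableSet_piece A
  have hYc : Yᶜ = IsDissipativeSystem.piece f W Aᶜ := hW.compl_piece A
  set B : ℝ := ((K * K) ^ (1 / p.toReal) : ℝ≥0) * D with hB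
  have hB0 : 0 ≤ B := mul_nonneg NNReal.zero_le_coe hD
  have hfwd : ∀ (j : ℕ), ∀ g ∈ lpVanishing μ p Yᶜ, ‖(T ^ (j : ℤ)) g‖ ≤ B * r ^ j * ‖g‖ := by
    intro j g hg
    refine (norm_zpow_le_of_ae_eq_zero hW hT hK hp (A := A) (mul_nonneg hD (pow_nonneg hr0.le j))
      (fun n hn => hfw n hn j) g (mem_lpVanishing.1 hg)).trans (le_of_eq ?_)
    rw [hB, mul_assoc (_ : ℝ) D]
  have hbwd : ∀ (j : ℕ), ∀ g ∈ lpVanishing μ p Y, ‖(T ^ (-j : ℤ)) g‖ ≤ B * r ^ j * ‖g‖ := by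
    intro j g hg
    refine (norm_zpow_le_of_ae_eq_zero hW hT hK hp (A := Aᶜ) (mul_nonneg hD (pow_nonneg hr0.le j))
      (fun n hn => hbw n hn j) g ?_).trans (le_of_eq ?_)
    · rw [← hYc, compl_compl]
      exact mem_lpVanishing.1 hg
    · rw [hB, mul_assoc (_ : ℝ) D]
  have hM : Set.MapsTo (T : Lp ℂ p μ →L[ℂ] Lp ℂ p μ) (lpVanishing μ p Yᶜ) (lpVanishing μ p Yᶜ) := by
    intro g hg
    refine zpow_mem_lpVanishing hW hT hYm.compl (n := 1) ?_ hg
    rw [hYc, IsDissipativeSystem.preimage_piece]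
    refine IsDissipativeSystem.piece_mono f W fun n hn hn' => hn ?_
    have := hA _ hn'
    rwa [sub_add_cancel] at this
  have hN : Set.MapsTo (T.symm : Lp ℂ p μ →L[ℂ] Lp ℂ p μ) (lpVanishing μ p Y)
      (lpVanishing μ p Y) := by
    intro g hg
    refine zpow_mem_lpVanishing hW hT hYm (n := -1) ?_ hg
    rw [IsDissipativeSystem.preimage_piece]
    refine IsDissipativeSystem.piece_mono f W fun n hn => ?_
    have := hA _ hn
    rwa [Set.mem_preimage, sub_neg_eq_add]
  have hMc := isClosed_lpVanishing (μ := μ) (p := p) Yᶜ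
  have hNc := isClosed_lpVanishing (μ := μ) (p := p) Y
  have : CompleteSpace (lpVanishing μ p Yᶜ) := hMc.completeSpace_coe
  have : CompleteSpace (lpVanishing μ p Y) := hNc.completeSpace_coe
  -- One power of norm below `1` on each summand is enough to locate the spectra.
  obtain ⟨j, hj⟩ : ∃ j : ℕ, B * r ^ j < 1 := by
    have h := (tendsto_pow_atTop_nhds_zero_of_lt_one hr0.le hr1).const_mul B
    rw [mul_zero] at h
    exact (h.eventually (gt_mem_nhds one_pos)).exists
  refine ⟨lpVanishing μ p Yᶜ, lpVanishing μ p Y, hMc, hNc, isCompl_lpVanishing hYm, hM, hN, ?_, ?_⟩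
  · refine spectrum_subset_ball_of_norm_pow_lt_one _ (n := j)
      ((ContinuousLinearMap.opNorm_le_bound _ (by positivity) fun g => ?_).trans_lt hj)
    rw [Submodule.coe_norm, Submodule.coe_norm, T.coe_restrict_pow hM]
    exact hfwd j g g.2
  · refine spectrum_subset_ball_of_norm_pow_lt_one _ (n := j)
      ((ContinuousLinearMap.opNorm_le_bound _ (by positivity) fun g => ?_).trans_lt hj)
    rw [Submodule.coe_norm, Submodule.coe_norm, T.coe_symm_restrict_pow hN]
    exact hbwd j g g.2

end Vanishing

theorem mainTheorem2 {X : Type*} [MeasurableSpace X] (μ : Measure X) (f : X ≃ᵐ X)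
    (p : ℝ≥0∞) [Fact (1 ≤ p)] (hp : p ≠ ∞)
    (hf : IsCompositionSystem μ f)
    (W : Set X) (hW : IsDissipativeSystemOfBoundedDistortion μ f W)
    (T : Lp ℂ p μ ≃L[ℂ] Lp ℂ p μ)
    (hT : (T : Lp ℂ p μ →L[ℂ] Lp ℂ p μ) = compositionOperator hf p) :
    (HasShadowingProperty T ↔ IsGeneralizedHyperbolic T) ∧
    (HasShadowingProperty T → IsStronglyStructurallyStable T) := by
  have hTf : ∀ g, T g =ᵐ[μ] g ∘ f := fun g => by
    rw [← T.coe_coe, hT]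
    exact compositionOperator_coeFn hf p g
  have hgh : HasShadowingProperty T → IsGeneralizedHyperbolic T := fun h =>
    h.isGeneralizedHyperbolic_of_dissipative hp hW hTf
  refine ⟨⟨hgh, fun h => ?_⟩, fun h => ?_⟩
  · obtain ⟨A, hA⟩ := h.exists_isGreenKernel
    exact hA.hasShadowingProperty
  · obtain ⟨A, hA⟩ := (hgh h).exists_isGreenKernel
    exact hA.isStronglyStructurallyStable
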